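/- Let $f_\gamma:\mathbb R^n\to\mathbb R^n$, $\gamma\in\Gamma=\{1,\dots,m\}$, be continuous. A switching signal is a right-continuous, piecewise constant function $\sigma:[0,\infty)\to\Gamma$ (finitely many discontinuities in every bounded interval); its switching times are its discontinuities. A trajectory of $\dot x=f_\sigma(x)$ is a pair $(x,\sigma)$, where $\sigma$ is a switching signal and $x:\mathcal I\to\mathbb R^n$, with $\mathcal I=[0,T)$ or $[0,T]$ and $0<T\le\infty$, is a continuous, piecewise $C^1$ curve with $\dot x(t)=f_{\sigma(t)}(x(t))$ for all $t\in\mathcal I$, $t>0$, that are not switching times. It is maximal if $x$ has no proper extension to such a solution for the same $\sigma$; $\mathcal T$ is the set of maximal trajectories, and $\mathcal I_{(x,\sigma)}$ is the domain of $x$. Let $\chi=\{\chi_\gamma\}_{\gamma\in\Gamma}$ be a closed covering of $\mathbb R^n$ (each $\chi_\gamma$ is closed and $\bigcup_\gamma\chi_\gamma=\mathbb R^n$), let $\Omega\subseteq\mathbb R^n$ be open, let $V:\Omega\times\Gamma\to\mathbb R$ be continuous, and let $\tau_D>0$ and $N_0\in\{0,1,2,\dots\}$. Define the following subsets of $\mathcal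 T$. * $\mathcal T[\chi]$: those $(x,\sigma)$ with $x(t)\in\chi_{\sigma(t)}$ for all $t\in\mathcal I_{(x,\sigma)}$. * $\mathcal T_a[\tau_D,N_0]$: those $(x,\sigma)$ such that, for all $0\le a<b<\infty$, $\sigma$ has at most $N_0+(b-a)/\tau_D$ switching times in $(a,b)$. * $\mathcal T_V$: those $(x,\sigma)$ with $x(t)\in\Omega$ for all $t\in\mathcal I_{(x,\sigma)}$ and $V(x(t),\sigma(t))\ge V(x(t'),\sigma(t'))$ for all $t\le t'$ in $\mathcal I_{(x,\sigma)}$ with $\sigma(t)=\sigma(t')$. * $\mathcal T_V^*$: those $(x,\sigma)\in\mathcal T_V$ with $V(x(t),\sigma(t))=V(x(t'),\sigma(t'))$ for all $t,t'\in\mathcal I_{(x,\sigma)}$ with $\sigma(t)=\sigma(t')$. A nonempty set $M\subseteq\mathbb R^n\times\Gamma$ is weakly-invariant with respect to $\mathcal F\subseteq\mathcal T$ if for each $(\xi,\gamma)\in M$ there is $(y,\rho)\in\mathcal F$ with $y(0)=\xi$, $\rho(0)=\gamma$ and $(y(t),\rho(t))\in M$ for all $t\in\mathcal I_{(y,\rho)}$.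 **Theorem.** Let $(x,\sigma)\in\mathcal T_V\cap\mathcal T[\chi]\cap\mathcal T_a[\tau_D,N_0]$ and suppose that, for some compact $B\subset\Omega$, $x(t)$ is defined and $x(t)\in B$ for all $t\ge 0$. Then there is a largest set $M$ among the subsets of $\Omega\times\Gamma$ that are weakly-invariant with respect to $\mathcal T_V^*\cap\mathcal T[\chi]\cap\mathcal T_a[\tau_D,N_0]$, and $x(t)$ converges to $\pi_1(M)$ as $t\to\infty$, i.e. $\lim_{t\to\infty}d(x(t),\pi_1(M))=0$, where $\pi_1:\mathbb R^n\times\Gamma\to\mathbb R^n$ is the projection onto the first component and $d(\xi,A)=\inf_{\eta\in A}|\xi-\eta|$ is the Euclidean distance. -/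

import Mathlib

open Set Filter Topology

namespace Switched

/-- The switching times `t₁ < t₂ < ⋯` of `σ : [0, ∞) → Γ`: its discontinuities in `(0, ∞)`.
The index set is `Γ = Fin m` with the discrete topology.
Signals are written as functions on `ℝ`; only their values on `[0, ∞)` are ever used. -/
def switchingTimes {m : ℕ} (σ : ℝ → Fin m) : Set ℝ :=
  {t | 0 < t ∧ ¬ ContinuousAt σ t}

/-- Switching signals: right-continuous and piecewise constant on `[0, ∞)`, i.e. with finitely many
discontinuities in every bounded interval (the values being discrete, a right-continuous signal
is constant on `[s, t)` whenever there is no discontinuity in `(s, t)`). -/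
structure IsSwitchingSignal {m : ℕ} (σ : ℝ → Fin m) : Prop where
  right_continuous : ∀ t, 0 ≤ t → ContinuousWithinAt σ (Ici t) t
  piecewise_constant : ∀ b, (switchingTimes σ ∩ Iic b).Finite

/-- `σ` has average dwell-time `τD` and chatter bound `N0`. -/
def HasAverageDwellTime {m : ℕ} (τD : ℝ) (N0 : ℕ) (σ : ℝ → Fin m) : Prop :=
  ∀ a b, 0 ≤ a → a < b →
    ((switchingTimes σ ∩ Ioo a b).ncard : ℝ) ≤ (N0 : ℝ) + (b - a) / τD

/-- The possible domains of solutions: `[0, T)` with `0 < T ≤ ∞`, or `[0, T]` with `0 < T < ∞`. -/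
def IsTimeInterval (I : Set ℝ) : Prop :=
  I = Ici 0 ∨ ∃ T, 0 < T ∧ (I = Ico 0 T ∨ I = Icc 0 T)

/-- `x : I → ℝⁿ` is a solution of `x' = f(x, σ)` corresponding to `σ`: a continuous curve that
satisfies the equation at every `t ∈ I`, `t > 0`, that is not a switching time. Since every `f γ`
is continuous, such a curve is `C¹` on each closed piece between switching times, i.e. it is
piecewise smooth. (At a right endpoint in `I` the derivative is the one-sided one.) -/
structure IsSolution {n m : ℕ} (f : Fin m → EuclideanSpace ℝ (Fin n) → EuclideanSpace ℝ (Fin n))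
    (σ : ℝ → Fin m) (I : Set ℝ) (x : ℝ → EuclideanSpace ℝ (Fin n)) : Prop where
  continuousOn : ContinuousOn x I
  hasDerivWithinAt : ∀ t ∈ I, 0 < t → t ∉ switchingTimes σ →
    HasDerivWithinAt x (f (σ t) (x t)) I t

/-- A pair `(x, σ)` together with the domain of `x`. The values of `x` off `dom` and of `σ` off
`[0, ∞)` are irrelevant. -/
structure Pair (n m : ℕ) where
  x : ℝ → EuclideanSpace ℝ (Fin n)
  σ : ℝ → Fin m
  dom : Set ℝ

/-- The set of all maximal trajectories of `x' = f(x, σ)`: `σ` is a switching signal and `x` is a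
solution corresponding to `σ` that has no proper extension to a solution. -/
def maxTraj {n m : ℕ} (f : Fin m → EuclideanSpace ℝ (Fin n) → EuclideanSpace ℝ (Fin n)) :
    Set (Pair n m) :=
  {p | IsSwitchingSignal p.σ ∧ IsTimeInterval p.dom ∧ IsSolution f p.σ p.dom p.x ∧
    ∀ (J : Set ℝ) (y : ℝ → EuclideanSpace ℝ (Fin n)), IsTimeInterval J → IsSolution f p.σ J y →
      p.dom ⊆ J → EqOn y p.x p.dom → J = p.dom}

/-- A closed covering of `ℝⁿ` indexed by `Γ`. -/
structure IsClosedCovering {n m : ℕ} (χ : Fin m → Set (EuclideanSpace ℝ (Fin n))) : Prop where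
  isClosed : ∀ γ, IsClosed (χ γ)
  covers : ⋃ γ, χ γ = univ

/-- The family `T[χ]`. -/
def trajCov {n m : ℕ} (f : Fin m → EuclideanSpace ℝ (Fin n) → EuclideanSpace ℝ (Fin n))
    (χ : Fin m → Set (EuclideanSpace ℝ (Fin n))) : Set (Pair n m) :=
  {p | p ∈ maxTraj f ∧ ∀ t ∈ p.dom, p.x t ∈ χ (p.σ t)}

/-- The family `T_a[τD, N0]`. -/
def trajDwell {n m : ℕ} (f : Fin m → EuclideanSpace ℝ (Fin n) → EuclideanSpace ℝ (Fin n))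
    (τD : ℝ) (N0 : ℕ) : Set (Pair n m) :=
  {p | p ∈ maxTraj f ∧ HasAverageDwellTime τD N0 p.σ}

/-- The family `T_V`, for `V : Ω × Γ → ℝ` (only the values of `V` on `Ω × Γ` are used). -/
def trajLyap {n m : ℕ} (f : Fin m → EuclideanSpace ℝ (Fin n) → EuclideanSpace ℝ (Fin n))
    (Ω : Set (EuclideanSpace ℝ (Fin n))) (V : EuclideanSpace ℝ (Fin n) × Fin m → ℝ) :
    Set (Pair n m) :=
  {p | p ∈ maxTraj f ∧ (∀ t ∈ p.dom, p.x t ∈ Ω) ∧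
    ∀ t ∈ p.dom, ∀ t' ∈ p.dom, t ≤ t' → p.σ t = p.σ t' →
      V (p.x t', p.σ t') ≤ V (p.x t, p.σ t)}

/-- The sub-family `T_V*` of `T_V`. -/
def trajLyapStar {n m : ℕ} (f : Fin m → EuclideanSpace ℝ (Fin n) → EuclideanSpace ℝ (Fin n))
    (Ω : Set (EuclideanSpace ℝ (Fin n))) (V : EuclideanSpace ℝ (Fin n) × Fin m → ℝ) :
    Set (Pair n m) :=
  {p | p ∈ trajLyap f Ω V ∧ ∀ t ∈ p.dom, ∀ t' ∈ p.dom, p.σ t = p.σ t' →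
      V (p.x t, p.σ t) = V (p.x t', p.σ t')}

/-- A nonempty set `M ⊆ ℝⁿ × Γ` is weakly-invariant with respect to the family `F`. -/
def IsWeaklyInvariant {n m : ℕ} (F : Set (Pair n m))
    (M : Set (EuclideanSpace ℝ (Fin n) × Fin m)) : Prop :=
  M.Nonempty ∧ ∀ q ∈ M, ∃ p ∈ F, p.x 0 = q.1 ∧ p.σ 0 = q.2 ∧
    ∀ t ∈ p.dom, (p.x t, p.σ t) ∈ M

end Switched

/-! ### Counting switching times, and a mean value estimate. -/

namespace Switched

/-! Every limit point of `x` at infinity lies on a limit trajectory, defined for all real times,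
along which `V` is constant in each mode; the range of that trajectory is weakly invariant. Along an
ultrafilter `U ≤ atTop` the shifts `x (s + t)` and `σ (s + t)` converge for every real `t`, by
compactness of `B` and finiteness of `Fin m`, to `y t` and `ρ₀ t`. The signal `ρ₀` need not be
right-continuous, but the dwell-time bound survives as a bound on its changes of value, so its right
limits exist and define `ρ`. The main difficulty is the equation for `y`, because the signals
converge only pointwise. `norm_sub_sub_smul_le_of_samples` overcomes it: few switches mean that
finitely many samples determine the signal up to a small set of times. Monotonicity of `V` becomes
constancy in `lyapunov_limit_le`. A union of weakly invariant sets is weakly invariant, so a largest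
one exists, and it contains all these ranges. -/

theorem card_le_ncard_of_pairwiseDisjoint {ι : Type*} {S : Set ℝ} (hS : S.Finite)
    (T : Finset ι) (I : ι → Set ℝ) (hI : (T : Set ι).PairwiseDisjoint I)
    (hne : ∀ i ∈ T, (I i ∩ S).Nonempty) : T.card ≤ S.ncard := by
  classical
  choose! c hc using hne
  rw [← Set.ncard_coe_finset]
  refine Set.ncard_le_ncard_of_injOn c (fun i hi => (hc i hi).2) ?_ hS
  intro i hi j hj hij
  by_contra hne
  exact Set.disjoint_left.1 (hI hi hj hne) (hc i hi).1 (hij ▸ (hc j hj).1)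

variable {m : ℕ} {σ : ℝ → Fin m}

theorem IsSwitchingSignal.eqOn_Icc (hσ : IsSwitchingSignal σ) {a b : ℝ} (ha : 0 ≤ a)
    (h : Disjoint (Ioc a b) (switchingTimes σ)) {s t : ℝ} (hs : s ∈ Icc a b) (ht : t ∈ Icc a b) :
    σ s = σ t := by
  have hc : ContinuousOn σ (Icc a b) := by
    intro u hu
    rcases hu.1.eq_or_lt with rfl | hau
    · exact (hσ.right_continuous _ ha).mono Icc_subset_Ici_self
    · have : u ∉ switchingTimes σ := Set.disjoint_left.1 h ⟨hau, hu.2⟩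
      have : ContinuousAt σ u := by
        by_contra hcu
        exact this ⟨ha.trans_lt hau, hcu⟩
      exact this.continuousWithinAt
  exact isPreconnected_Icc.constant hc hs ht

theorem IsSwitchingSignal.exists_switchingTime (hσ : IsSwitchingSignal σ) {a b : ℝ} (ha : 0 ≤ a)
    (hab : a ≤ b) (h : σ a ≠ σ b) : (Ioc a b ∩ switchingTimes σ).Nonempty := by
  rw [← Set.not_disjoint_iff_nonempty_inter]
  exact fun hd => h (hσ.eqOn_Icc ha hd (left_mem_Icc.2 hab) (right_mem_Icc.2 hab))

theorem IsSwitchingSignal.finite_inter_Ioo (hσ : IsSwitchingSignal σ) (a b : ℝ) :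
    (switchingTimes σ ∩ Ioo a b).Finite :=
  (hσ.piecewise_constant b).subset (inter_subset_inter_right _ fun _ h => h.2.le)

theorem HasAverageDwellTime.card_le {τD : ℝ} {N0 : ℕ} (hσ : IsSwitchingSignal σ)
    (hN : HasAverageDwellTime τD N0 σ) {A B : ℝ} (hA : 0 ≤ A) (hAB : A < B) {ι : Type*}
    (T : Finset ι) (a b : ι → ℝ) (hAa : ∀ i ∈ T, A ≤ a i) (hbB : ∀ i ∈ T, b i < B)
    (hd : (T : Set ι).PairwiseDisjoint fun i => Ioc (a i) (b i))
    (hne : ∀ i ∈ T, (Ioc (a i) (b i) ∩ switchingTimes σ).Nonempty) :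
    (T.card : ℝ) ≤ N0 + (B - A) / τD := by
  refine le_trans ?_ (hN A B hA hAB)
  have := card_le_ncard_of_pairwiseDisjoint (hσ.finite_inter_Ioo A B) T _ hd fun i hi => by
    obtain ⟨t, ht, hts⟩ := hne i hi
    exact ⟨t, ht, hts, (hAa i hi).trans_lt ht.1, ht.2.trans_lt (hbB i hi)⟩
  exact_mod_cast this

variable {E : Type*} [NormedAddCommGroup E] [NormedSpace ℝ E]

theorem norm_sub_sub_smul_le_of_right_deriv {x g : ℝ → E} {a b : ℝ}
    (hab : a ≤ b) (hx : ContinuousOn x (Icc a b)) (hg : ∀ t ∈ Ico a b, HasDerivWithinAt x (g t) (Ici t) t) {v : E} {C : ℝ}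
    (hC : ∀ t ∈ Ico a b, ‖g t - v‖ ≤ C) : ‖x b - x a - (b - a) • v‖ ≤ C * (b - a) := by
  have key := norm_image_sub_le_of_norm_deriv_right_le_segment (f := fun t => x t - t • v)
    (f' := fun t => g t - v) (a := a) (b := b) (C := C)
    (by fun_prop) (fun t ht => by
      simpa using (hg t ht).fun_sub (((hasDerivAt_id t).smul_const v).hasDerivWithinAt)) hC b
    (right_mem_Icc.2 hab)
  convert key using 2
  rw [sub_smul]; abel

end Switched

/-! ### Right derivatives of solutions, and the sampling estimate. -/

namespace Switched

section RightDerivative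

variable {n m : ℕ} {f : Fin m → EuclideanSpace ℝ (Fin n) → EuclideanSpace ℝ (Fin n)}
  {σ : ℝ → Fin m} {x : ℝ → EuclideanSpace ℝ (Fin n)}

theorem eventually_eq_of_rightContinuous {t : ℝ} (h : ContinuousWithinAt σ (Ici t) t) :
    ∀ᶠ s in 𝓝[≥] t, σ s = σ t := by
  have := h.tendsto
  rw [nhds_discrete, tendsto_pure] at this
  exact this

/-- At `0` and at switching times the equation is not assumed. The right derivative there is the
right limit of the derivative, since `σ` is constant just after `t`. -/
theorem IsSolution.hasDerivWithinAt_Ici (hf : ∀ γ, Continuous (f γ)) (hσ : IsSwitchingSignal σ)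
    (hx : IsSolution f σ (Ici 0) x) {t : ℝ} (ht : 0 ≤ t) :
    HasDerivWithinAt x (f (σ t) (x t)) (Ici t) t := by
  obtain ⟨u, htu, hu⟩ := mem_nhdsGE_iff_exists_Ico_subset.1
    (eventually_eq_of_rightContinuous (hσ.right_continuous t ht))
  have hder : ∀ s ∈ Ioo t u, HasDerivAt x (f (σ t) (x s)) s := by
    intro s hs
    have hs0 : 0 < s := ht.trans_lt hs.1
    have hev : σ =ᶠ[𝓝 s] fun _ => σ t := by
      filter_upwards [Ioo_mem_nhds hs.1 hs.2] with r hr using hu ⟨hr.1.le, hr.2⟩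
    have hns : s ∉ switchingTimes σ := fun h =>
      h.2 (continuousAt_const.congr hev.symm)
    have := (hx.hasDerivWithinAt s hs0.le hs0 hns).hasDerivAt (Ici_mem_nhds hs0)
    rwa [hev.eq_of_nhds] at this
  have hxc : ContinuousWithinAt x (Ici t) t :=
    (hx.continuousOn t ht).mono (Ici_subset_Ici.2 ht)
  refine hasDerivWithinAt_Ici_of_tendsto_deriv (s := Ioo t u)
    (fun s hs => (hder s hs).differentiableAt.differentiableWithinAt)
    (hxc.mono fun s hs => hs.1.le) (Ioo_mem_nhdsGT htu) ?_
  have hlim : Tendsto (fun s => f (σ t) (x s)) (𝓝[>] t) (𝓝 (f (σ t) (x t))) :=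
    ((hf (σ t)).tendsto _).comp (hxc.mono Ioi_subset_Ici_self)
  refine hlim.congr' ?_
  filter_upwards [Ioo_mem_nhdsGT htu] with s hs using (hder s hs).deriv.symm

/-- Near `t` the signal is constant, so the mean value inequality for right derivatives applies on
intervals on either side of `t`. -/
theorem hasDerivAt_of_right_deriv (hf : ∀ γ, Continuous (f γ)) (hx : Continuous x)
    (hd : ∀ t, HasDerivWithinAt x (f (σ t) (x t)) (Ici t) t) {t : ℝ} (ht : ContinuousAt σ t) :
    HasDerivAt x (f (σ t) (x t)) t := by
  rw [hasDerivAt_iff_isLittleO, Asymptotics.isLittleO_iff]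
  intro ε hε
  have h1 : ∀ᶠ s in 𝓝 t, σ s = σ t := by
    have := ht.tendsto
    rwa [nhds_discrete (Fin m), tendsto_pure] at this
  have h2 : ∀ᶠ s in 𝓝 t, ‖f (σ t) (x s) - f (σ t) (x t)‖ < ε := by
    have : ContinuousAt (fun s => f (σ t) (x s)) t := ((hf _).comp hx).continuousAt
    simpa [dist_eq_norm] using Metric.tendsto_nhds.1 this ε hε
  obtain ⟨l, u, htlu, hlu⟩ := mem_nhds_iff_exists_Ioo_subset.1 (h1.and h2)
  have key : ∀ c d, l < c → c ≤ d → d < u →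
      ‖x d - x c - (d - c) • f (σ t) (x t)‖ ≤ ε * (d - c) := by
    intro c d hc hcd hdu
    refine norm_sub_sub_smul_le_of_right_deriv hcd hx.continuousOn (fun s _ => hd s) ?_
    intro s hs
    obtain ⟨e1, e2⟩ := hlu ⟨hc.trans_le hs.1, hs.2.trans hdu⟩
    rw [e1]
    exact e2.le
  filter_upwards [Ioo_mem_nhds htlu.1 htlu.2] with s hs
  rcases le_total t s with h | h
  · rw [Real.norm_of_nonneg (sub_nonneg.2 h)]
    exact key t s htlu.1 h hs.2
  · rw [Real.norm_of_nonpos (sub_nonpos.2 h), neg_sub, ← norm_neg]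
    have e : -(x s - x t - (s - t) • f (σ t) (x t)) = x t - x s - (t - s) • f (σ t) (x t) := by
      rw [sub_smul, sub_smul]; abel
    rw [e]
    exact key s t hs.1 h htlu.2

end RightDerivative

variable {m : ℕ} {σ : ℝ → Fin m} {E : Type*} [NormedAddCommGroup E] [NormedSpace ℝ E]

/-- Cut `[a, b]` into `K` cells and sample `σ` at the midpoints. In a cell without switching times
`σ` equals `γ` and the error is at most `ε` times the length; a cell with one costs at most `2 * C`
times the length. The dwell-time bound limits the number of bad cells independently of `K`, so their
total cost vanishes as `K → ∞`. -/
theorem norm_sub_sub_smul_le_of_samples {f : Fin m → E → E} {x : ℝ → E}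
    (hσ : IsSwitchingSignal σ) {τD : ℝ} {N0 : ℕ} (hN : HasAverageDwellTime τD N0 σ)
    {a b : ℝ} (ha : 0 ≤ a) (hab : a < b) (hx : ContinuousOn x (Icc a b))
    (hd : ∀ t ∈ Ico a b, HasDerivWithinAt x (f (σ t) (x t)) (Ici t) t)
    {K : ℕ} (hK : 0 < K) {γ : Fin m} {v : E} {ε C : ℝ} (hε : 0 ≤ ε) (hC : ‖v‖ ≤ C)
    (hfC : ∀ t ∈ Ico a b, ‖f (σ t) (x t)‖ ≤ C) (hfε : ∀ t ∈ Ico a b, ‖f γ (x t) - v‖ ≤ ε)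
    (hγ : ∀ i < K, σ (a + (i + 1 / 2) * ((b - a) / K)) = γ) :
    ‖x b - x a - (b - a) • v‖ ≤
      ε * (b - a) + (N0 + (b + 1 - a) / τD) * (2 * C * ((b - a) / K)) := by
  classical
  have hK0 : (0 : ℝ) < K := by exact_mod_cast hK
  set h : ℝ := (b - a) / K with hh
  have hpos : 0 < h := div_pos (sub_pos.2 hab) hK0
  have hKh : K * h = b - a := by rw [hh]; field_simp
  have hC0 : 0 ≤ C := (norm_nonneg v).trans hC
  set c : ℕ → ℝ := fun i => a + i * h with hc
  have hcs : ∀ i, c (i + 1) - c i = h := fun i => by simp only [hc]; push_cast; ring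
  have hcm : StrictMono c := strictMono_nat_of_lt_succ fun i => by linarith [hcs i]
  have hc0 : c 0 = a := by simp [hc]
  have hcK : c K = b := by simp only [hc]; linarith
  have hca : ∀ i, a ≤ c i := fun i => hc0 ▸ hcm.monotone (Nat.zero_le i)
  have hcb : ∀ i < K, c (i + 1) ≤ b := fun i hi => hcK ▸ hcm.monotone hi
  set bad := (Finset.range K).filter fun i =>
    (Ioc (c i) (c (i + 1)) ∩ switchingTimes σ).Nonempty with hbad
  -- The last cell contains `b`, whereas switching times are counted in open intervals; hence `b +
  -- 1`.
  have hcard : (bad.card : ℝ) ≤ N0 + (b + 1 - a) / τD := by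
    refine HasAverageDwellTime.card_le hσ hN ha (by linarith) bad c (fun i => c (i + 1))
      (fun i _ => hca i) (fun i hi => ?_) (fun i _ j _ hij => ?_) fun i hi => ?_
    · have := hcb i (by simpa using (Finset.mem_filter.1 hi).1)
      linarith
    · exact hcm.monotone.pairwise_disjoint_on_Ioc_succ hij
    · exact (Finset.mem_filter.1 hi).2
  have hcell : ∀ i ∈ Finset.range K, ‖x (c (i + 1)) - x (c i) - h • v‖ ≤
      ε * h + if i ∈ bad then 2 * C * h else 0 := by
    intro i hi
    have hiK := Finset.mem_range.1 hi
    have hsub : Ico (c i) (c (i + 1)) ⊆ Ico a b := Ico_subset_Ico (hca i) (hcb i hiK)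
    have hle : c i ≤ c (i + 1) := (hcm i.lt_succ_self).le
    have hx' : ContinuousOn x (Icc (c i) (c (i + 1))) := hx.mono (Icc_subset_Icc (hca i) (hcb i hiK))
    have mv : ∀ {D : ℝ}, (∀ t ∈ Ico (c i) (c (i + 1)), ‖f (σ t) (x t) - v‖ ≤ D) →
        ‖x (c (i + 1)) - x (c i) - h • v‖ ≤ D * h := by
      intro D hD
      have := norm_sub_sub_smul_le_of_right_deriv hle hx' (fun t ht => hd t (hsub ht)) hD
      rwa [hcs] at this
    by_cases hib : i ∈ bad
    · rw [if_pos hib]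
      have := mv (D := 2 * C) fun t ht => by
        have := hfC t (hsub ht)
        linarith [norm_sub_le (f (σ t) (x t)) v]
      have : 0 ≤ ε * h := by positivity
      linarith
    · rw [if_neg hib, add_zero]
      have hdisj : Disjoint (Ioc (c i) (c (i + 1))) (switchingTimes σ) := by
        rw [← Set.not_nonempty_iff_eq_empty.trans Set.disjoint_iff_inter_eq_empty.symm]
        exact fun hne => hib (Finset.mem_filter.2 ⟨hi, hne⟩)
      refine mv fun t ht => ?_
      have hmid : a + (i + 1 / 2) * h ∈ Icc (c i) (c (i + 1)) := by
        simp only [hc]; push_cast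
        constructor <;> nlinarith
      rw [hσ.eqOn_Icc (ha.trans (hca i)) hdisj (Ico_subset_Icc_self ht) hmid, hγ i hiK]
      exact hfε t (hsub ht)
  have htel : x b - x a - (b - a) • v = ∑ i ∈ Finset.range K, (x (c (i + 1)) - x (c i) - h • v) := by
    rw [Finset.sum_sub_distrib, Finset.sum_range_sub (fun i => x (c i)), hc0, hcK, ← hKh]
    simp [mul_smul, Nat.cast_smul_eq_nsmul]
  rw [htel]
  refine (norm_sum_le_of_le _ hcell).trans ?_
  rw [Finset.sum_add_distrib, ← Finset.sum_filter]
  have hfil : (Finset.range K).filter (fun i => i ∈ bad) = bad := by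
    ext i; simp [hbad]
  rw [hfil, Finset.sum_const, Finset.sum_const, Finset.card_range, nsmul_eq_mul, nsmul_eq_mul]
  have : (K : ℝ) * (ε * h) = ε * (b - a) := by rw [← hKh]; ring
  rw [this]
  gcongr

end Switched

/-! ### Limits of switching signals. -/

namespace Switched

variable {m : ℕ}

/-- Over any `(A, B)`, the function `σ` changes value on at most `N0 + (B - A) / τD` disjoint
intervals. -/
def HasChangeBound (τD : ℝ) (N0 : ℕ) (σ : ℝ → Fin m) : Prop :=
  ∀ A B : ℝ, A < B → ∀ (ι : Type) (T : Finset ι) (a b : ι → ℝ), (∀ i ∈ T, A ≤ a i) →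
    (∀ i ∈ T, a i ≤ b i) → (∀ i ∈ T, b i < B) →
    ((T : Set ι).PairwiseDisjoint fun i => Ioc (a i) (b i)) → (∀ i ∈ T, σ (a i) ≠ σ (b i)) →
    (T.card : ℝ) ≤ N0 + (B - A) / τD

/-- `ρ` is the right limit of `ρ₀` at every point. -/
def IsRightGerm (ρ₀ ρ : ℝ → Fin m) : Prop :=
  ∀ t, ∀ᶠ s in 𝓝[>] t, ρ₀ s = ρ t

variable {τD : ℝ} {N0 : ℕ} {σ ρ₀ ρ : ℝ → Fin m}

/-- The bound involves finitely many values of `ρ₀`, all realised by a single shift of `σ`; each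
change of value of `σ` forces a switching time. -/
theorem HasAverageDwellTime.hasChangeBound_limit (hσ : IsSwitchingSignal σ)
    (hN : HasAverageDwellTime τD N0 σ) {U : Filter ℝ} [U.NeBot] (hU : U ≤ atTop)
    (hlim : ∀ t, ∀ᶠ s in U, σ (s + t) = ρ₀ t) : HasChangeBound τD N0 ρ₀ := by
  intro A B hAB ι T a b hAa hab hbB hd hne
  have h1 : ∀ᶠ s in U, ∀ i ∈ T, σ (s + a i) = ρ₀ (a i) ∧ σ (s + b i) = ρ₀ (b i) :=
    (Filter.eventually_all_finset T).2 fun i _ => (hlim _).and (hlim _)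
  obtain ⟨s, hs, hs0⟩ := (h1.and (hU (eventually_ge_atTop (-A)))).exists
  have := HasAverageDwellTime.card_le hσ hN (A := s + A) (B := s + B) (by linarith) (by linarith) T
    (fun i => s + a i) (fun i => s + b i) (fun i hi => by linarith [hAa i hi])
    (fun i hi => by linarith [hbB i hi])
    (fun i hi j hj hij => by
      have := hd hi hj hij
      simp only [Function.onFun, Set.disjoint_left, mem_Ioc] at this ⊢
      intro r hr hr'
      exact this (a := r - s) ⟨by linarith, by linarith⟩ ⟨by linarith, by linarith⟩)
    (fun i hi => hσ.exists_switchingTime (by linarith [hAa i hi]) (by linarith [hab i hi]) (by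
      rw [(hs i hi).1, (hs i hi).2]; exact hne i hi))
  simpa using this

/-- Without a right limit at `t`, changes of value occur arbitrarily close to the right of `t`,
giving infinitely many disjoint change intervals in `(t, t + 1)`. -/
theorem HasChangeBound.exists_isRightGerm (h : HasChangeBound τD N0 ρ₀) :
    ∃ ρ, IsRightGerm ρ₀ ρ := by
  suffices ∀ t, ∃ γ, ∀ᶠ s in 𝓝[>] t, ρ₀ s = γ by
    choose ρ hρ using this
    exact ⟨ρ, hρ⟩
  intro t
  by_contra hcon
  have step : ∀ u, t < u → ∃ a b, t < a ∧ a ≤ b ∧ b < u ∧ ρ₀ a ≠ ρ₀ b := by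
    intro u hu
    by_contra hno
    push Not at hno
    refine hcon ⟨ρ₀ ((t + u) / 2), ?_⟩
    filter_upwards [Ioo_mem_nhdsGT (show t < (t + u) / 2 by linarith)] with s hs
    exact hno s _ hs.1 hs.2.le (by linarith)
  choose! a b hta hab hbu hne using step
  -- Each change interval is chosen to the left of the start of the previous one, which makes them
  -- disjoint.
  set u : ℕ → ℝ := fun k => a^[k] (t + 1) with hu
  have hus : ∀ k, u (k + 1) = a (u k) := fun k => Function.iterate_succ_apply' _ _ _
  have htu : ∀ k, t < u k := by
    intro k
    induction k with
    | zero => simp [hu]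
    | succ k ih => rw [hus]; exact hta _ ih
  have hanti : Antitone u := antitone_nat_of_succ_le fun k => by
    rw [hus]; exact (hab _ (htu k)).trans (hbu _ (htu k)).le
  obtain ⟨k, hk⟩ := exists_nat_gt ((N0 : ℝ) + (t + 1 - t) / τD)
  have := h t (t + 1) (by linarith) ℕ (Finset.range k) (fun i => u (i + 1)) (fun i => b (u i))
    (fun i _ => (htu _).le) (fun i _ => by rw [hus]; exact hab _ (htu i))
    (fun i _ => (hbu _ (htu i)).trans_le (hanti (Nat.zero_le i)))
    (fun i _ j _ hij => (hanti.pairwise_disjoint_on_Ioc_succ hij).mono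
      (Ioc_subset_Ioc_right (hbu _ (htu i)).le) (Ioc_subset_Ioc_right (hbu _ (htu j)).le))
    (fun i _ => by rw [hus]; exact hne _ (htu i))
  rw [Finset.card_range] at this
  linarith

theorem IsRightGerm.continuousWithinAt_Ici (h : IsRightGerm ρ₀ ρ) (t : ℝ) :
    ContinuousWithinAt ρ (Ici t) t := by
  rw [← continuousWithinAt_Ioi_iff_Ici]
  refine tendsto_nhds_of_eventually_eq ?_
  filter_upwards [eventually_eventually_nhdsWithin.2 (h t), self_mem_nhdsWithin] with s hs hts
  have hs' : ∀ᶠ r in 𝓝[>] s, ρ₀ r = ρ t :=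
    hs.filter_mono (nhdsWithin_mono _ (Ioi_subset_Ioi (le_of_lt hts)))
  obtain ⟨r, h1, h2⟩ := (hs'.and (h s)).exists
  exact h2.symm.trans h1

theorem IsRightGerm.frequently_ne_of_not_continuousAt (h : IsRightGerm ρ₀ ρ) {t : ℝ}
    (ht : ¬ ContinuousAt ρ t) : ∃ᶠ s in 𝓝[<] t, ρ₀ s ≠ ρ t := by
  intro hcon
  refine ht (continuousAt_iff_continuous_left'_right'.2 ⟨?_, (h.continuousWithinAt_Ici t).mono Ioi_subset_Ici_self⟩)
  refine tendsto_nhds_of_eventually_eq ?_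
  filter_upwards [eventually_eventually_nhdsWithin.2 hcon, self_mem_nhdsWithin] with s hs hst
  rw [isOpen_Iio.nhdsWithin_eq hst] at hs
  obtain ⟨r, h1, h2⟩ := ((hs.filter_mono (nhdsWithin_le_nhds (s := Ioi s))).and (h s)).exists
  exact h2.symm.trans (not_not.1 h1)

/-- Around a discontinuity `t` of `ρ`, `ρ₀` takes the value `ρ t` just after `t` and another value
just before it. Taken in disjoint neighbourhoods, these give disjoint change intervals. -/
theorem IsRightGerm.card_discontinuities_le (h : IsRightGerm ρ₀ ρ)
    (hb : HasChangeBound τD N0 ρ₀) {A B : ℝ} (hAB : A < B) (T : Finset ℝ)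
    (hT : ∀ t ∈ T, ¬ ContinuousAt ρ t ∧ t ∈ Ioo A B) : (T.card : ℝ) ≤ N0 + (B - A) / τD := by
  obtain ⟨W, hW, hWd⟩ := T.finite_toSet.t2_separation
  have step : ∀ t ∈ T, ∃ a b, a ≤ b ∧ Icc a b ⊆ W t ∩ Ioo A B ∧ ρ₀ a ≠ ρ₀ b := by
    intro t ht
    obtain ⟨l, u, htlu, hlu⟩ := mem_nhds_iff_exists_Ioo_subset.1
      (inter_mem ((hW t).2.mem_nhds (hW t).1) (Ioo_mem_nhds (hT t ht).2.1 (hT t ht).2.2))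
    obtain ⟨a, ha, ha1, ha2⟩ := ((h.frequently_ne_of_not_continuousAt (hT t ht).1).and_eventually
      (Ioo_mem_nhdsLT htlu.1)).exists
    obtain ⟨b, hb, hb1, hb2⟩ := ((h t).and (Ioo_mem_nhdsGT htlu.2)).exists
    exact ⟨a, b, (ha2.trans hb1).le, (Icc_subset_Ioo ha1 hb2).trans hlu, hb ▸ ha⟩
  choose! a b hab hsub hne using step
  refine hb A B hAB ℝ T a b (fun t ht => (hsub t ht (left_mem_Icc.2 (hab t ht))).2.1.le) hab
    (fun t ht => (hsub t ht (right_mem_Icc.2 (hab t ht))).2.2) (fun t ht r hr htr => ?_) hne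
  have hI : ∀ t ∈ T, Ioc (a t) (b t) ⊆ W t := fun t ht =>
    Ioc_subset_Icc_self.trans ((hsub t ht).trans inter_subset_left)
  exact (hWd ht hr htr).mono (hI t ht) (hI r hr)

end Switched

/-! ### Passing to the limit in the differential equation. -/

namespace Switched

variable {n m : ℕ} {f : Fin m → EuclideanSpace ℝ (Fin n) → EuclideanSpace ℝ (Fin n)}
  {χ : Fin m → Set (EuclideanSpace ℝ (Fin n))} {Ω B : Set (EuclideanSpace ℝ (Fin n))}
  {V : EuclideanSpace ℝ (Fin n) × Fin m → ℝ} {τD : ℝ} {N0 : ℕ}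
  {x y : ℝ → EuclideanSpace ℝ (Fin n)} {σ ρ₀ ρ : ℝ → Fin m}

theorem IsTimeInterval.subset_Ici {I : Set ℝ} (h : IsTimeInterval I) : I ⊆ Ici 0 := by
  rcases h with rfl | ⟨T, -, rfl | rfl⟩
  · exact subset_rfl
  · exact Ico_subset_Ici_self
  · exact Icc_subset_Ici_self

theorem IsRightGerm.mem_invariantFamily (hf : ∀ γ, Continuous (f γ))
    (hρ : IsRightGerm ρ₀ ρ) (hb : HasChangeBound τD N0 ρ₀) (hy : Continuous y)
    (hd : ∀ t, HasDerivWithinAt y (f (ρ t) (y t)) (Ici t) t) (hΩ : ∀ t, y t ∈ Ω)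
    (hχ : ∀ t, y t ∈ χ (ρ t)) (hV : ∀ t t', ρ t = ρ t' → V (y t, ρ t) = V (y t', ρ t')) (r : ℝ) :
    (⟨fun t => y (r + t), fun t => ρ (r + t), Ici 0⟩ : Pair n m) ∈
      trajLyapStar f Ω V ∩ trajCov f χ ∩ trajDwell f τD N0 := by
  have hcont : ∀ t, ContinuousAt ρ (r + t) → ContinuousAt (fun t => ρ (r + t)) t := fun t ht =>
    ContinuousAt.comp (f := fun t => r + t) ht (by fun_prop)
  -- Stated for finite subsets because `ncard` of an infinite set is `0`; finiteness is then deduced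
  -- from this bound.
  have hcard : ∀ A B, A < B → ∀ T : Finset ℝ,
      (T : Set ℝ) ⊆ switchingTimes (fun t => ρ (r + t)) ∩ Ioo A B →
        (T.card : ℝ) ≤ N0 + (B - A) / τD := by
    intro A B hAB T hT
    have := hρ.card_discontinuities_le hb (A := r + A) (B := r + B) (by linarith)
      (T.map (addLeftEmbedding r)) (fun t ht => by
        obtain ⟨s, hs, rfl⟩ := Finset.mem_map.1 ht
        obtain ⟨⟨-, h1⟩, h2, h3⟩ := hT hs
        exact ⟨fun h => h1 (hcont s h), by simpa using h2, by simpa using h3⟩)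
    simpa using this
  have hfin : ∀ A B, A < B → (switchingTimes (fun t => ρ (r + t)) ∩ Ioo A B).Finite := by
    intro A B hAB
    by_contra hinf
    obtain ⟨k, hk⟩ := exists_nat_gt ((N0 : ℝ) + (B - A) / τD)
    obtain ⟨T, hT, hTk⟩ := Set.Infinite.exists_subset_card_eq hinf k
    have := hcard A B hAB T hT
    rw [hTk] at this
    linarith
  have hsig : IsSwitchingSignal (fun t => ρ (r + t)) := by
    refine ⟨fun t _ => ?_, fun b => ?_⟩
    · exact ContinuousWithinAt.comp (f := fun t => r + t) (hρ.continuousWithinAt_Ici (r + t))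
        (by fun_prop) fun s hs => by simpa using hs
    · refine (hfin 0 (max b 0 + 1) (by positivity)).subset fun t ht => ⟨ht.1, ht.1.1, ?_⟩
      have := ht.2
      have := le_max_left b 0
      simp only [mem_Iic] at *
      linarith
  have hsol : IsSolution f (fun t => ρ (r + t)) (Ici 0) (fun t => y (r + t)) := by
    refine ⟨by fun_prop, fun t _ ht hts => ?_⟩
    have hc : ContinuousAt (fun t => ρ (r + t)) t := by
      by_contra h
      exact hts ⟨ht, h⟩
    refine (hasDerivAt_of_right_deriv (σ := fun t => ρ (r + t)) hf (by fun_prop) (fun s => ?_)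
      hc).hasDerivWithinAt
    have h1 : HasDerivWithinAt (fun t => r + t) 1 (Ici s) s :=
      ((hasDerivAt_id s).const_add r).hasDerivWithinAt
    have := HasDerivWithinAt.scomp (t' := Ici (r + s)) s (hd (r + s)) h1
      (fun q hq => by simpa using hq)
    rw [one_smul] at this
    exact this
  have hmax : (⟨fun t => y (r + t), fun t => ρ (r + t), Ici 0⟩ : Pair n m) ∈ maxTraj f :=
    -- Maximality is automatic: no time interval exceeds `Ici 0`.
    ⟨hsig, Or.inl rfl, hsol, fun J z hJ _ hsub _ => hJ.subset_Ici.antisymm hsub⟩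
  refine ⟨⟨⟨⟨hmax, fun t _ => hΩ _, fun t _ t' _ _ h => (hV _ _ h).ge⟩, fun t _ t' _ h => hV _ _ h⟩,
    hmax, fun t _ => hχ _⟩, hmax, fun a b _ hab => ?_⟩
  have := hcard a b hab (hfin a b hab).toFinset (by simp)
  rwa [Set.ncard_eq_toFinset_card _ (hfin a b hab)]

theorem exists_pointwise_limits (hB : IsCompact B) (hxB : ∀ t, 0 ≤ t → x t ∈ B)
    (σ : ℝ → Fin m) {U : Ultrafilter ℝ} (hU : (U : Filter ℝ) ≤ atTop) :
    ∃ (y : ℝ → EuclideanSpace ℝ (Fin n)) (ρ₀ : ℝ → Fin m),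
      (∀ t, y t ∈ B) ∧ (∀ t, Tendsto (fun s => x (s + t)) U (𝓝 (y t))) ∧
      ∀ t, ∀ᶠ s in U, σ (s + t) = ρ₀ t := by
  have h1 : ∀ t, ∃ z ∈ B, Tendsto (fun s => x (s + t)) U (𝓝 z) := by
    intro t
    refine hB.ultrafilter_le_nhds (U.map fun s => x (s + t)) (le_principal_iff.2 ?_)
    change ∀ᶠ s in U, x (s + t) ∈ B
    filter_upwards [hU (eventually_ge_atTop (-t))] with s hs
    exact hxB _ (by linarith)
  have h2 : ∀ t, ∃ γ, ∀ᶠ s in U, σ (s + t) = γ := by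
    intro t
    obtain ⟨γ, -, hγ⟩ := isCompact_univ.ultrafilter_le_nhds (U.map fun s => σ (s + t)) (by simp)
    refine ⟨γ, ?_⟩
    have hγ' : Tendsto (fun s => σ (s + t)) U (𝓝 γ) := hγ
    rwa [nhds_discrete (Fin m), tendsto_pure] at hγ'
  choose y hyB hy using h1
  choose ρ₀ hρ₀ using h2
  exact ⟨y, ρ₀, hyB, hy, hρ₀⟩

/-- Just after `t`, `ρ₀` equals `ρ t`, so for fixed `K` the `K + 1` samples of a late shift of `σ`
all equal `ρ t`. The sampling estimate passes to the limit along `U`, and then `K → ∞`. -/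
theorem hasDerivWithinAt_limit (hf : ∀ γ, Continuous (f γ)) (hσ : IsSwitchingSignal σ)
    (hN : HasAverageDwellTime τD N0 σ) (hx : IsSolution f σ (Ici 0) x)
    {C : ℝ} (hC : ∀ γ, ∀ z ∈ B, ‖f γ z‖ ≤ C) (hxB : ∀ t, 0 ≤ t → x t ∈ B)
    {U : Filter ℝ} [U.NeBot] (hU : U ≤ atTop) (hyB : ∀ t, y t ∈ B)
    (hlim : ∀ t, Tendsto (fun s => x (s + t)) U (𝓝 (y t)))
    (hσlim : ∀ t, ∀ᶠ s in U, σ (s + t) = ρ₀ t) (hρ : IsRightGerm ρ₀ ρ) (t : ℝ) :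
    HasDerivWithinAt y (f (ρ t) (y t)) (Ici t) t := by
  have hd := fun {t} => hx.hasDerivWithinAt_Ici hf hσ (t := t)
  have hC0 : 0 ≤ C := (norm_nonneg _).trans (hC (ρ t) _ (hyB t))
  rw [hasDerivWithinAt_iff_isLittleO, Asymptotics.isLittleO_iff]
  intro ε hε
  set v := f (ρ t) (y t) with hv
  obtain ⟨η, hη, hfη⟩ := Metric.continuousAt_iff.1 (hf (ρ t)).continuousAt ε hε
  obtain ⟨u, htu, hu⟩ := mem_nhdsGT_iff_exists_Ioo_subset.1 (hρ t)
  -- Half of `η` absorbs the drift of `x` over a time `b - t`, the other half the distance from `x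
  -- (s + t)` to `y t`.
  have hsmall : ∀ᶠ b in 𝓝[≥] t, C * (b - t) < η / 2 := by
    have : Tendsto (fun b => C * (b - t)) (𝓝[≥] t) (𝓝 (C * (t - t))) :=
      (Continuous.tendsto (by fun_prop) t).mono_left nhdsWithin_le_nhds
    exact this.eventually_lt_const (by simpa using half_pos hη)
  filter_upwards [hsmall, Ico_mem_nhdsGE htu] with b hCb hb
  rcases hb.1.eq_or_lt with rfl | htb
  · simp
  rw [Real.norm_of_nonneg (sub_nonneg.2 htb.le)]
  have hlimb : Tendsto (fun s => ‖x (s + b) - x (s + t) - (b - t) • v‖) U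
      (𝓝 ‖y b - y t - (b - t) • v‖) :=
    (((hlim b).sub (hlim t)).sub_const _).norm
  have hK : ∀ K : ℕ, ‖y b - y t - (b - t) • v‖ ≤
      ε * (b - t) + (N0 + (b + 1 - t) / τD) * (2 * C * ((b - t) / ((K + 1 : ℕ) : ℝ))) := by
    intro K
    have hKpos : (0 : ℝ) < ((K + 1 : ℕ) : ℝ) := by positivity
    have hsamp : ∀ᶠ s in U, ∀ i ∈ Finset.range (K + 1),
        σ (s + (t + (i + 1 / 2) * ((b - t) / ((K + 1 : ℕ) : ℝ)))) = ρ t := by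
      refine (Filter.eventually_all_finset _).2 fun i hi => ?_
      have hi' : (i : ℝ) + 1 ≤ ((K + 1 : ℕ) : ℝ) := by
        exact_mod_cast Finset.mem_range.1 hi
      have hpos : 0 < (b - t) / ((K + 1 : ℕ) : ℝ) := div_pos (by linarith) hKpos
      have hle : ((i : ℝ) + 1 / 2) * ((b - t) / ((K + 1 : ℕ) : ℝ)) ≤ b - t := by
        calc _ ≤ ((K + 1 : ℕ) : ℝ) * ((b - t) / ((K + 1 : ℕ) : ℝ)) := by gcongr; linarith
          _ = b - t := by field_simp
      have hmem : ρ₀ (t + (i + 1 / 2) * ((b - t) / ((K + 1 : ℕ) : ℝ))) = ρ t :=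
        hu ⟨by have : 0 < ((i : ℝ) + 1 / 2) * ((b - t) / ((K + 1 : ℕ) : ℝ)) := by positivity
               linarith, by linarith [hb.2]⟩
      filter_upwards [hσlim (t + (i + 1 / 2) * ((b - t) / ((K + 1 : ℕ) : ℝ)))] with s hs
      rw [hs, hmem]
    have hnear : ∀ᶠ s in U, dist (x (s + t)) (y t) < η / 2 :=
      (Metric.tendsto_nhds.1 (hlim t)) _ (half_pos hη)
    refine le_of_tendsto hlimb ?_
    filter_upwards [hsamp, hnear, hU (eventually_ge_atTop (-t))] with s hs1 hs2 hs3
    have hs0 : 0 ≤ s + t := by linarith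
    have hxc : ContinuousOn x (Icc (s + t) (s + b)) :=
      hx.continuousOn.mono fun r hr => hs0.trans hr.1
    have hdr : ∀ r ∈ Ico (s + t) (s + b), HasDerivWithinAt x (f (σ r) (x r)) (Ici r) r :=
      fun r hr => hd (hs0.trans hr.1)
    have := norm_sub_sub_smul_le_of_samples (f := f) hσ hN hs0 (by linarith : s + t < s + b) hxc hdr
      K.succ_pos (γ := ρ t) (v := v) hε.le (hC _ _ (hyB t))
      (fun r hr => hC _ _ (hxB r (hs0.trans hr.1)))
      (fun r hr => by
        have h1 := norm_image_sub_le_of_norm_deriv_right_le_segment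
          (hxc.mono (Icc_subset_Icc_right hr.2.le))
          (fun q hq => hdr q ⟨hq.1, hq.2.trans hr.2⟩)
          (fun q hq => hC _ _ (hxB q (hs0.trans hq.1))) r (right_mem_Icc.2 hr.1)
        have h2 : C * (r - (s + t)) ≤ C * (b - t) :=
          mul_le_mul_of_nonneg_left (by linarith [hr.2]) hC0
        have h3 : dist (x r) (y t) < η := by
          have := dist_triangle (x r) (x (s + t)) (y t)
          rw [dist_eq_norm (x r) (x (s + t))] at this
          linarith
        have := hfη h3
        rw [dist_eq_norm] at this
        exact this.le)
      (fun i hi => by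
        have := hs1 i (Finset.mem_range.2 hi)
        rw [add_sub_add_left_eq_sub, add_assoc]
        exact this)
    rwa [add_sub_add_left_eq_sub, add_assoc, add_sub_add_left_eq_sub] at this
  refine ge_of_tendsto (f := fun K : ℕ => ε * (b - t) + (N0 + (b + 1 - t) / τD) *
    (2 * C * ((b - t) / ((K + 1 : ℕ) : ℝ)))) (x := atTop) ?_ (Eventually.of_forall hK)
  have h0 : Tendsto (fun K : ℕ => (b - t) / ((K + 1 : ℕ) : ℝ)) atTop (𝓝 0) :=
    (tendsto_const_div_atTop_nhds_zero_nat (b - t)).comp (tendsto_add_atTop_nat 1)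
  simpa using ((h0.const_mul (2 * C)).const_mul ((N0 : ℝ) + (b + 1 - t) / τD)).const_add
    (ε * (b - t))

end Switched

/-! ### The limit trajectory and weakly invariant sets. -/

namespace Switched

variable {n m : ℕ} {f : Fin m → EuclideanSpace ℝ (Fin n) → EuclideanSpace ℝ (Fin n)}
  {χ : Fin m → Set (EuclideanSpace ℝ (Fin n))} {Ω B : Set (EuclideanSpace ℝ (Fin n))}
  {V : EuclideanSpace ℝ (Fin n) × Fin m → ℝ} {τD : ℝ} {N0 : ℕ}
  {x y : ℝ → EuclideanSpace ℝ (Fin n)} {σ ρ₀ ρ : ℝ → Fin m}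

theorem exists_bound_vectorFields (hf : ∀ γ, Continuous (f γ)) (hB : IsCompact B) :
    ∃ C, ∀ γ, ∀ z ∈ B, ‖f γ z‖ ≤ C := by
  choose c hc using fun γ => hB.exists_bound_of_continuousOn (hf γ).continuousOn
  obtain ⟨C, hC⟩ := Finite.exists_le c
  exact ⟨C, fun γ z hz => (hc γ z hz).trans (hC γ)⟩

theorem continuous_limit (hf : ∀ γ, Continuous (f γ)) (hσ : IsSwitchingSignal σ)
    (hx : IsSolution f σ (Ici 0) x) {C : ℝ} (hC : ∀ γ, ∀ z ∈ B, ‖f γ z‖ ≤ C)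
    (hxB : ∀ t, 0 ≤ t → x t ∈ B) {U : Filter ℝ} [U.NeBot] (hU : U ≤ atTop)
    (hlim : ∀ t, Tendsto (fun s => x (s + t)) U (𝓝 (y t))) : Continuous y := by
  have hC0 : 0 ≤ C := (norm_nonneg _).trans (hC (σ 0) _ (hxB 0 le_rfl))
  have key : ∀ a b, a ≤ b → dist (y a) (y b) ≤ C * dist a b := by
    intro a b hab
    refine le_of_tendsto ((hlim a).dist (hlim b)) ?_
    filter_upwards [hU (eventually_ge_atTop (-a))] with s hs
    have hs0 : 0 ≤ s + a := by linarith
    have := norm_image_sub_le_of_norm_deriv_right_le_segment (f := x) (a := s + a) (b := s + b)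
      (hx.continuousOn.mono fun r hr => hs0.trans hr.1)
      (fun r hr => hx.hasDerivWithinAt_Ici hf hσ (hs0.trans hr.1))
      (fun r hr => hC _ _ (hxB r (hs0.trans hr.1))) (s + b) (right_mem_Icc.2 (by linarith))
    rwa [add_sub_add_left_eq_sub, ← dist_eq_norm, ← Real.norm_of_nonneg (sub_nonneg.2 hab),
      ← dist_eq_norm, dist_comm, dist_comm b a] at this
  refine (LipschitzWith.of_dist_le_mul (K := ⟨C, hC0⟩) fun a b => ?_).continuous
  rcases le_total a b with h | h
  · exact key a b h
  · rw [dist_comm (y a), dist_comm a]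
    exact key b a h

/-- The order of `t` and `t'` is irrelevant: with `s₀` fixed, a later shift `s` puts `s + t` after
`s₀ + t'`. Taking the limit in `s`, then in `s₀`, gives the inequality, and exchanging `t` and `t'`
gives equality. -/
theorem lyapunov_limit_le (hV : ContinuousOn V (Ω ×ˢ univ)) (hΩ : IsOpen Ω)
    (hmono : ∀ t, 0 ≤ t → ∀ t', 0 ≤ t' → t ≤ t' → σ t = σ t' →
      V (x t', σ t') ≤ V (x t, σ t))
    {U : Filter ℝ} [U.NeBot] (hU : U ≤ atTop)
    (hlim : ∀ t, Tendsto (fun s => x (s + t)) U (𝓝 (y t))) (hyΩ : ∀ t, y t ∈ Ω)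
    (hσlim : ∀ t, ∀ᶠ s in U, σ (s + t) = ρ₀ t) {t t' : ℝ} (h : ρ₀ t = ρ₀ t') :
    V (y t, ρ₀ t) ≤ V (y t', ρ₀ t') := by
  have hVlim : ∀ t, Tendsto (fun s => V (x (s + t), ρ₀ t)) U (𝓝 (V (y t, ρ₀ t))) := fun t =>
    (hV.continuousAt ((hΩ.prod isOpen_univ).mem_nhds ⟨hyΩ t, mem_univ _⟩)).tendsto.comp
      ((hlim t).prodMk_nhds tendsto_const_nhds)
  refine ge_of_tendsto (hVlim t') ?_
  filter_upwards [hσlim t', hU (eventually_ge_atTop (-t'))] with s₀ hs₀ hs₀'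
  refine le_of_tendsto (hVlim t) ?_
  filter_upwards [hσlim t, hU (eventually_ge_atTop (s₀ + t' - t))] with s hs hs'
  have := hmono (s₀ + t') (by linarith) (s + t) (by linarith) (by linarith) (by rw [hs₀, hs, h])
  rwa [hs₀, hs] at this

theorem exists_limit_trajectory (hf : ∀ γ, Continuous (f γ)) (hχ : ∀ γ, IsClosed (χ γ))
    (hΩ : IsOpen Ω) (hV : ContinuousOn V (Ω ×ˢ univ)) (hB : IsCompact B) (hBΩ : B ⊆ Ω)
    (hσ : IsSwitchingSignal σ) (hN : HasAverageDwellTime τD N0 σ) (hx : IsSolution f σ (Ici 0) x)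
    (hxB : ∀ t, 0 ≤ t → x t ∈ B) (hxχ : ∀ t, 0 ≤ t → x t ∈ χ (σ t))
    (hmono : ∀ t, 0 ≤ t → ∀ t', 0 ≤ t' → t ≤ t' → σ t = σ t' →
      V (x t', σ t') ≤ V (x t, σ t))
    {U : Ultrafilter ℝ} (hU : (U : Filter ℝ) ≤ atTop) :
    ∃ (y : ℝ → EuclideanSpace ℝ (Fin n)) (ρ : ℝ → Fin m),
      Tendsto x U (𝓝 (y 0)) ∧ ∀ r, (⟨fun t => y (r + t), fun t => ρ (r + t), Ici 0⟩ : Pair n m) ∈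
        trajLyapStar f Ω V ∩ trajCov f χ ∩ trajDwell f τD N0 := by
  obtain ⟨C, hC⟩ := exists_bound_vectorFields hf hB
  obtain ⟨y, ρ₀, hyB, hlim, hσlim⟩ := exists_pointwise_limits hB hxB σ hU
  have hyΩ : ∀ t, y t ∈ Ω := fun t => hBΩ (hyB t)
  have hb := hN.hasChangeBound_limit hσ hU hσlim
  obtain ⟨ρ, hρ⟩ := hb.exists_isRightGerm
  have hy := continuous_limit hf hσ hx hC hxB hU hlim
  have hyχ : ∀ t, y t ∈ χ (ρ₀ t) := fun t => by
    refine (hχ _).mem_of_tendsto (hlim t) ?_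
    filter_upwards [hσlim t, hU (eventually_ge_atTop (-t))] with s hs hs'
    exact hs ▸ hxχ _ (by linarith)
  have hy' : ∀ t, Tendsto y (𝓝[>] t) (𝓝 (y t)) := fun t => (hy.tendsto t).mono_left nhdsWithin_le_nhds
  have hVy : ∀ t t', ρ₀ t = ρ₀ t' → V (y t, ρ₀ t) = V (y t', ρ₀ t') := fun t t' h =>
    (lyapunov_limit_le hV hΩ hmono hU hlim hyΩ hσlim h).antisymm
      (lyapunov_limit_le hV hΩ hmono hU hlim hyΩ hσlim h.symm)
  -- `ρ t` is the value of `ρ₀` at times just after `t`, so constancy for `ρ₀` passes to `ρ` by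
  -- continuity of `V` and `y`.
  have hVρ : ∀ t t', ρ t = ρ₀ t' → V (y t, ρ t) = V (y t', ρ₀ t') := by
    intro t t' h
    have h1 : Tendsto (fun s => V (y s, ρ t)) (𝓝[>] t) (𝓝 (V (y t, ρ t))) :=
      (hV.continuousAt ((hΩ.prod isOpen_univ).mem_nhds ⟨hyΩ t, mem_univ _⟩)).tendsto.comp
        ((hy' t).prodMk_nhds tendsto_const_nhds)
    refine tendsto_nhds_unique_of_eventuallyEq h1 tendsto_const_nhds ?_
    filter_upwards [hρ t] with s hs
    rw [← hs]
    exact hVy s t' (hs.trans h)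
  refine ⟨y, ρ, by simpa using hlim 0, fun r => hρ.mem_invariantFamily hf hb hy
    (hasDerivWithinAt_limit hf hσ hN hx hC hxB hU hyB hlim hσlim hρ) hyΩ (fun t => ?_)
    (fun t t' h => ?_) r⟩
  · refine (hχ _).mem_of_tendsto (hy' t) ?_
    filter_upwards [hρ t] with s hs
    exact hs ▸ hyχ s
  · obtain ⟨s, hs⟩ := (hρ t).exists
    rw [hVρ t s hs.symm, hVρ t' s (h.symm.trans hs.symm)]

/-- The shift by `r` starts at the point of parameter `r`, which is why negative shifts are needed
as well. -/
theorem isWeaklyInvariant_range {F : Set (Pair n m)}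
    (h : ∀ r, (⟨fun t => y (r + t), fun t => ρ (r + t), Ici 0⟩ : Pair n m) ∈ F) :
    IsWeaklyInvariant F (range fun t => (y t, ρ t)) := by
  refine ⟨range_nonempty _, ?_⟩
  rintro _ ⟨r, rfl⟩
  exact ⟨_, h r, by simp, by simp, fun t _ => ⟨r + t, rfl⟩⟩

theorem IsWeaklyInvariant.isGreatest_sUnion {F : Set (Pair n m)}
    {S : Set (EuclideanSpace ℝ (Fin n) × Fin m)}
    (hne : ∃ M, IsWeaklyInvariant F M ∧ M ⊆ S) :
    IsGreatest {M | IsWeaklyInvariant F M ∧ M ⊆ S} (⋃₀ {M | IsWeaklyInvariant F M ∧ M ⊆ S}) := by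
  refine ⟨⟨⟨?_, ?_⟩, sUnion_subset fun M hM => hM.2⟩, fun M hM => subset_sUnion_of_mem hM⟩
  · obtain ⟨M, hM⟩ := hne
    exact hM.1.1.mono (subset_sUnion_of_mem hM)
  · rintro q ⟨M, hM, hq⟩
    obtain ⟨p, hp, h0, h0', hpM⟩ := hM.1.2 q hq
    exact ⟨p, hp, h0, h0', fun t ht => ⟨M, hM, hpM t ht⟩⟩

end Switched

/-! ### The invariance principle. -/

theorem theorem4 {n m : ℕ}
    (f : Fin m → EuclideanSpace ℝ (Fin n) → EuclideanSpace ℝ (Fin n))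
    (hf : ∀ γ, Continuous (f γ))
    (χ : Fin m → Set (EuclideanSpace ℝ (Fin n))) (hχ : Switched.IsClosedCovering χ)
    (Ω : Set (EuclideanSpace ℝ (Fin n))) (hΩ : IsOpen Ω)
    (V : EuclideanSpace ℝ (Fin n) × Fin m → ℝ) (hV : ContinuousOn V (Ω ×ˢ univ))
    (τD : ℝ) (hτD : 0 < τD) (N0 : ℕ)
    (p : Switched.Pair n m)
    (hp : p ∈ Switched.trajLyap f Ω V ∩ Switched.trajCov f χ ∩ Switched.trajDwell f τD N0)
    (B : Set (EuclideanSpace ℝ (Fin n))) (hB : IsCompact B) (hBΩ : B ⊆ Ω)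
    (hpB : ∀ t, 0 ≤ t → t ∈ p.dom ∧ p.x t ∈ B) :
    ∃ M : Set (EuclideanSpace ℝ (Fin n) × Fin m),
      IsGreatest {M' | Switched.IsWeaklyInvariant
          (Switched.trajLyapStar f Ω V ∩ Switched.trajCov f χ ∩ Switched.trajDwell f τD N0) M' ∧
          M' ⊆ Ω ×ˢ univ} M ∧
      Tendsto (fun t : ℝ => Metric.infDist (p.x t) (Prod.fst '' M)) atTop (𝓝 0) := by
  obtain ⟨⟨⟨⟨hσ, hI, hx, -⟩, -, hmono⟩, -, hxχ⟩, -, hN⟩ := hp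
  have hdom : p.dom = Ici 0 := hI.subset_Ici.antisymm fun t ht => (hpB t ht).1
  rw [hdom] at hx
  have hlim : ∀ U : Ultrafilter ℝ, (U : Filter ℝ) ≤ atTop →
      ∃ M, (Switched.IsWeaklyInvariant
        (Switched.trajLyapStar f Ω V ∩ Switched.trajCov f χ ∩ Switched.trajDwell f τD N0) M ∧
          M ⊆ Ω ×ˢ univ) ∧ ∃ q ∈ M, Tendsto p.x U (𝓝 q.1) := by
    intro U hU
    obtain ⟨y, ρ, hy0, hmem⟩ := Switched.exists_limit_trajectory hf hχ.isClosed hΩ hV hB hBΩ hσ hN hx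
      (fun t ht => (hpB t ht).2) (fun t ht => hxχ t (hpB t ht).1)
      (fun t ht t' ht' => hmono t (hpB t ht).1 t' (hpB t' ht').1) hU
    refine ⟨_, ⟨Switched.isWeaklyInvariant_range hmem, ?_⟩, _, mem_range_self 0, hy0⟩
    rintro _ ⟨r, rfl⟩
    have := (hmem r).1.1.1.2.1 0 self_mem_Ici
    exact ⟨by simpa using this, mem_univ _⟩
  have hgreat := Switched.IsWeaklyInvariant.isGreatest_sUnion <| by
    obtain ⟨M, hM, -⟩ := hlim (Ultrafilter.of atTop) (Ultrafilter.of_le _)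
    exact ⟨M, hM⟩
  -- Convergence is tested on ultrafilters: along each one `x` tends to a point of `Prod.fst '' M`
  -- for some weakly invariant `M`, which the largest one contains.
  refine ⟨_, hgreat, (tendsto_iff_ultrafilter _ _ _).2 fun U hU => ?_⟩
  obtain ⟨M, hM, q, hq, hqlim⟩ := hlim U hU
  refine squeeze_zero (fun t => Metric.infDist_nonneg) (fun t => ?_) (tendsto_iff_dist_tendsto_zero.1 hqlim)
  exact Metric.infDist_le_dist_of_mem (mem_image_of_mem _ (hgreat.2 hM hq))
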